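/- Let $\Lambda$ be an associative ring with identity. For left $\Lambda$-modules $A,B$ let $P(A,B)\subseteq \mathrm{Hom}_\Lambda(A,B)$ be the subgroup of homomorphisms that factor through a projective module, and let $(\underline{A,-})$ be the covariant functor $B\mapsto \mathrm{Hom}_\Lambda(A,B)/P(A,B)$ from left $\Lambda$-modules to abelian groups. A functor $F$ from left $\Lambda$-modules to abelian groups is finitely presented if there are left modules $X,Y$, a homomorphism $f:X\to Y$ and a componentwise exact sequence of functors $\mathrm{Hom}_\Lambda(Y,-)\to\mathrm{Hom}_\Lambda(X,-)\to F\to 0$ whose first map is induced by $f$. The ring $\Lambda$ is left hereditary if every left ideal is projective, left perfect if every left module has a projective cover, and right coherent if every finitely generated right ideal is finitely presented. **Proposition.** Assume that $\Lambda$ is left hereditary. Then $(\underline{A,-})$ is finitely presented for all left $\Lambda$-modules $A$ if and only if $\Lambda$ is left perfect and right coherent. In particular, the path algebra $\Lambda=KQ$ of a finite quiver $Q$ without oriented cycles over a field $K$ is left hereditary, left perfect and right coherent, and $(\underline{A,-})$ is finitely presented for all left $KQ$-modules $A$. -/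

import Mathlib

open CategoryTheory Opposite

universe u v w t

namespace StableHom

section Rings

/-- A ring is left hereditary if every left ideal is a projective left module. -/
def IsLeftHereditary (Λ : Type u) [Ring Λ] : Prop :=
  ∀ I : Submodule Λ Λ, Module.Projective Λ I

/-- A submodule `N` of `M` is superfluous (small) if `L + N = M` implies `L = M`. -/
def IsSuperfluous {Λ : Type u} [Ring Λ] {M : Type v} [AddCommGroup M] [Module Λ M]
    (N : Submodule Λ M) : Prop :=
  ∀ L : Submodule Λ M, L ⊔ N = ⊤ → L = ⊤

/-- A projective cover: an epimorphism from a projective module with superfluous kernel. -/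
structure IsProjectiveCover {Λ : Type u} [Ring Λ] {P M : Type u} [AddCommGroup P] [Module Λ P]
    [AddCommGroup M] [Module Λ M] (p : P →ₗ[Λ] M) : Prop where
  projective : Module.Projective Λ P
  surjective : Function.Surjective p
  superfluous : IsSuperfluous (LinearMap.ker p)

/-- A ring is left perfect if every left module has a projective cover. -/
def IsLeftPerfect (Λ : Type u) [Ring Λ] : Prop :=
  ∀ M : ModuleCat.{u} Λ, ∃ (P : ModuleCat.{u} Λ) (p : P →ₗ[Λ] M), IsProjectiveCover p

/-- A ring is right coherent if every finitely generated right ideal is a finitely presented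
right module. Right modules over `Λ` are modules over `Λᵐᵒᵖ`. -/
def IsRightCoherent (Λ : Type u) [Ring Λ] : Prop :=
  ∀ I : Submodule Λᵐᵒᵖ Λ, I.FG → Module.FinitePresentation Λᵐᵒᵖ I

end Rings

section Functors

variable {Λ : Type u} [Ring Λ]

/-- A functor `F` from left modules to abelian groups is finitely presented if there are a
homomorphism `f : X ⟶ Y` and a componentwise exact sequence `(Y, -) ⟶ (X, -) ⟶ F ⟶ 0` whose
first map is induced by `f`. -/
def IsFinitelyPresentedFunctor (F : ModuleCat.{u} Λ ⥤ AddCommGrpCat.{u}) : Prop :=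
  ∃ (X Y : ModuleCat.{u} Λ) (f : X ⟶ Y) (π : preadditiveCoyoneda.obj (op X) ⟶ F),
    ∀ B : ModuleCat.{u} Λ,
      Function.Exact ((preadditiveCoyoneda.map f.op).app B) (π.app B) ∧
        Function.Surjective (π.app B)

/-- The group `P(A, B)` of all maps `A ⟶ B` which factor through a projective module. -/
def projectiveMaps (A B : ModuleCat.{u} Λ) : AddSubgroup (A ⟶ B) where
  carrier := {h | ∃ (P : ModuleCat.{u} Λ) (i : A ⟶ P) (q : P ⟶ B),
    Module.Projective Λ P ∧ i ≫ q = h}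
  zero_mem' := ⟨ModuleCat.of Λ PUnit, 0, 0, inferInstance, by simp⟩
  add_mem' := by
    rintro _ _ ⟨P, i, q, hP, rfl⟩ ⟨P', i', q', hP', rfl⟩
    refine ⟨ModuleCat.of Λ (P × P'), ModuleCat.ofHom (i.hom.prod i'.hom),
      ModuleCat.ofHom (q.hom.coprod q'.hom), inferInstance, ?_⟩
    ext x
    simp
  neg_mem' := by
    rintro _ ⟨P, i, q, hP, rfl⟩
    exact ⟨P, i, -q, hP, by simp⟩

/-- The covariant Hom functor modulo projectives: `B` is sent to `(A, B) / P(A, B)`. -/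
def stableHom (A : ModuleCat.{u} Λ) : ModuleCat.{u} Λ ⥤ AddCommGrpCat.{u} where
  obj B := AddCommGrpCat.of ((A ⟶ B) ⧸ projectiveMaps A B)
  map {B C} g := AddCommGrpCat.ofHom <|
    QuotientAddGroup.map (projectiveMaps A B) (projectiveMaps A C)
      (Preadditive.rightComp A g) (by
        rintro _ ⟨P, i, q, hP, rfl⟩
        exact ⟨P, i, q ≫ g, hP, by simp [Preadditive.rightComp]⟩)
  map_id B := by
    ext x
    simp [Preadditive.rightComp]
  map_comp {B C D} g g' := by
    ext x
    simp [Preadditive.rightComp]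

end Functors

end StableHom

section PathAlgebra

/-- A quiver has no oriented cycles if every path from a vertex to itself is trivial. -/
def Quiver.HasNoOrientedCycles (Q : Type v) [Quiver.{w} Q] : Prop :=
  ∀ (a : Q) (p : Quiver.Path a a), p = Quiver.Path.nil

/-- The set of all paths of a quiver, including the trivial ones: a path is recorded with its
source and its target. -/
abbrev Quiver.AllPaths (Q : Type v) [Quiver.{w} Q] : Type max v w :=
  Σ a b : Q, Quiver.Path a b

/-- The path algebra: the free `K`-module on the set of all paths, multiplied by concatenation. -/
def PathAlgebra (K : Type t) [CommRing K] (Q : Type v) [Quiver.{w} Q] : Type max t v w :=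
  Quiver.AllPaths Q →₀ K

namespace PathAlgebra

variable (K : Type t) [CommRing K] (Q : Type v) [Quiver.{w} Q]

noncomputable instance instAddCommGroup : AddCommGroup (PathAlgebra K Q) :=
  inferInstanceAs (AddCommGroup (Quiver.AllPaths Q →₀ K))

noncomputable instance instModule : Module K (PathAlgebra K Q) :=
  inferInstanceAs (Module K (Quiver.AllPaths Q →₀ K))

variable {Q}

/-- The basis element of the path algebra given by a path. -/
noncomputable def path {a b : Q} (p : Quiver.Path a b) : PathAlgebra K Q :=
  Finsupp.single (⟨a, b, p⟩ : Quiver.AllPaths Q) (1 : K)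

open Classical in
/-- The product of two paths `p`, `q`: first `p`, then `q`, if `p` ends where `q` starts, and `0`
otherwise. -/
noncomputable def pathMul (p q : Quiver.AllPaths Q) : PathAlgebra K Q :=
  if h : p.2.1 = q.1 then path K (p.2.2.comp (q.2.2.cast h.symm rfl)) else 0

variable (Q)

/-- The bilinear extension of the product of paths. -/
noncomputable def mulHom : PathAlgebra K Q →ₗ[K] PathAlgebra K Q →ₗ[K] PathAlgebra K Q :=
  Finsupp.lift (PathAlgebra K Q →ₗ[K] PathAlgebra K Q) K (Quiver.AllPaths Q) fun p =>
    Finsupp.lift (PathAlgebra K Q) K (Quiver.AllPaths Q) fun q => pathMul K p q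

variable {K Q}

theorem mulHom_path {a b c d : Q} (p : Quiver.Path a b) (q : Quiver.Path c d) :
    mulHom K Q (path K p) (path K q) = pathMul K ⟨a, b, p⟩ ⟨c, d, q⟩ := by
  have h1 : mulHom K Q (path K p) = (1 : K) • Finsupp.lift (PathAlgebra K Q) K
      (Quiver.AllPaths Q) fun q => pathMul K ⟨a, b, p⟩ q :=
    (Finsupp.lift_apply _ _ _ _ _).trans (Finsupp.sum_single_index (zero_smul K _))
  rw [h1, one_smul]
  refine ((Finsupp.lift_apply _ _ _ _ _).trans (Finsupp.sum_single_index (zero_smul K _))).trans ?_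
  exact one_smul K _

theorem mulHom_path_comp {a b c : Q} (p : Quiver.Path a b) (q : Quiver.Path b c) :
    mulHom K Q (path K p) (path K q) = path K (p.comp q) := by
  rw [mulHom_path]; simp [pathMul]

theorem mulHom_path_of_ne {a b c d : Q} (p : Quiver.Path a b) (q : Quiver.Path c d) (h : b ≠ c) :
    mulHom K Q (path K p) (path K q) = 0 := by
  rw [mulHom_path]; simp [pathMul, h]

theorem induction_on {C : PathAlgebra K Q → Prop} (x : PathAlgebra K Q) (zero : C 0)
    (add : ∀ x y, C x → C y → C (x + y))
    (smul_path : ∀ (r : K) (a b : Q) (p : Quiver.Path a b), C (r • path K p)) : C x := by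
  refine Finsupp.induction_linear (motive := C) x zero add ?_
  rintro ⟨a, b, p⟩ r
  have h : r • path K p = (Finsupp.single (⟨a, b, p⟩ : Quiver.AllPaths Q) r) :=
    Finsupp.smul_single_one _ r
  exact h ▸ smul_path r a b p

theorem mulHom_assoc (x y z : PathAlgebra K Q) :
    mulHom K Q (mulHom K Q x y) z = mulHom K Q x (mulHom K Q y z) := by
  induction x using induction_on with
  | zero => simp
  | add x x' hx hx' => simp [hx, hx']
  | smul_path r a b p =>
  induction y using induction_on with
  | zero => simp
  | add y y' hy hy' => simp only [map_add, LinearMap.add_apply, hy, hy']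
  | smul_path s c d q =>
  induction z using induction_on with
  | zero => simp
  | add z z' hz hz' => simp only [map_add, hz, hz']
  | smul_path t e f l =>
  simp only [map_smul, LinearMap.smul_apply]
  congr 3
  by_cases h : b = c
  · subst h
    by_cases h' : d = e
    · subst h'
      simp only [mulHom_path_comp, Quiver.Path.comp_assoc]
    · rw [mulHom_path_comp, mulHom_path_of_ne _ _ h', mulHom_path_of_ne _ _ h', map_zero]
  · rw [mulHom_path_of_ne _ _ h]
    by_cases h' : d = e
    · subst h'
      rw [mulHom_path_comp, mulHom_path_of_ne _ _ h]
      simp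
    · rw [mulHom_path_of_ne _ _ h']
      simp

variable (K Q) in
/-- The identity element: the sum of the trivial paths. -/
noncomputable def unit [Fintype Q] : PathAlgebra K Q :=
  ∑ a : Q, path K (Quiver.Path.nil : Quiver.Path a a)

theorem unit_mulHom [Fintype Q] (x : PathAlgebra K Q) : mulHom K Q (unit K Q) x = x := by
  induction x using induction_on with
  | zero => simp
  | add x x' hx hx' => simp only [map_add, hx, hx']
  | smul_path r a b p =>
    rw [map_smul, unit, map_sum, LinearMap.sum_apply, Finset.sum_eq_single a,
      mulHom_path_comp, Quiver.Path.nil_comp]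
    · intro c _ hc
      exact mulHom_path_of_ne _ _ hc
    · simp

theorem mulHom_unit [Fintype Q] (x : PathAlgebra K Q) : mulHom K Q x (unit K Q) = x := by
  induction x using induction_on with
  | zero => simp
  | add x x' hx hx' => simp only [map_add, LinearMap.add_apply, hx, hx']
  | smul_path r a b p =>
    rw [map_smul, LinearMap.smul_apply, unit, map_sum, Finset.sum_eq_single b,
      mulHom_path_comp, Quiver.Path.comp_nil]
    · intro c _ hc
      exact mulHom_path_of_ne _ _ hc.symm
    · simp

noncomputable instance instRing [Fintype Q] : Ring (PathAlgebra K Q) where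
  __ := (inferInstance : AddCommGroup (PathAlgebra K Q))
  mul x y := mulHom K Q x y
  one := unit K Q
  left_distrib x y z := map_add (mulHom K Q x) y z
  right_distrib x y z := LinearMap.map_add₂ (mulHom K Q) x y z
  zero_mul x := LinearMap.map_zero₂ (mulHom K Q) x
  mul_zero x := map_zero (mulHom K Q x)
  mul_assoc := mulHom_assoc
  one_mul := unit_mulHom
  mul_one := mulHom_unit

noncomputable instance instAlgebra [Fintype Q] : Algebra K (PathAlgebra K Q) :=
  Algebra.ofModule (fun r x y => LinearMap.map_smul₂ (mulHom K Q) r x y)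
    (fun r x y => map_smul (mulHom K Q x) r y)

end PathAlgebra

end PathAlgebra

/-! The link is the notion of a projective preenvelope: a map `g : A ⟶ P` with `P` projective
through which every map from `A` to a projective factors. If `g` exists, `P(A, -)` is the image of
`(P, -) → (A, -)`, so the stable functor is finitely presented. Conversely, Yoneda turns a
presentation into a preenvelope (`exists_isProjectivePreenvelope`).

If every module has a preenvelope, that of `Λ^X` splits, so all products `Λ^X` are projective. By
Chase's argument this forces the descending chain condition on principal right ideals and right
coherence (`principalRightDCC_of_projective_pi`, `isRightCoherent_of_projective_pi`). By Bass, the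
chain condition makes `Λ` left perfect (`PrincipalRightDCC.isLeftPerfect`). In the other direction,
coherence makes products of free modules flat, and flat modules with a projective cover are
projective. The map from `A` into a large enough product of free modules is then a preenvelope.

For an acyclic finite quiver `KQ` is finite-dimensional, hence left perfect and right coherent. It
is hereditary because the projective cover of a left ideal is injective: its kernel is radical, and
independence of the arrows kills it vertex by vertex, starting at the sinks. -/

namespace StableHom

/-! ### Bass: descending chains of principal right ideals and projective covers. -/

section Perfect

/-- The descending chain condition on principal right ideals. -/
def PrincipalRightDCC (Λ : Type u) [Ring Λ] : Prop :=
  WellFounded fun y x : Λ => (∃ b, y = x * b) ∧ ∀ r, x ≠ y * r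

theorem exists_mul_one_sub_eq_one_of_mem_jacobson {Λ : Type u} [Ring Λ] {x : Λ}
    (hx : x ∈ Ring.jacobson Λ) : ∃ t, (1 - x) * t = 1 := by
  have key : ∀ y ∈ Ring.jacobson Λ, ∃ z, z * (1 - y) = 1 := by
    intro y hy
    rw [← Ideal.jacobson_bot, Ideal.mem_jacobson_iff] at hy
    obtain ⟨z, hz⟩ := hy (-1)
    refine ⟨z, ?_⟩
    rw [Ideal.mem_bot] at hz
    rw [← sub_eq_zero, ← hz]
    noncomm_ring
  obtain ⟨z, hz⟩ := key x hx
  have h1 : z = 1 - -(z * x) := by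
    rw [mul_sub, mul_one] at hz; rw [← hz]; abel
  obtain ⟨s, hs⟩ := key (-(z * x)) (neg_mem (Ideal.mul_mem_left _ _ hx))
  rw [← h1] at hs
  refine ⟨z, ?_⟩
  have : s = 1 - x := by
    calc s = s * (z * (1 - x)) := by rw [hz, mul_one]
      _ = 1 - x := by rw [← mul_assoc, hs, one_mul]
  rw [← this, hs]

theorem eq_zero_of_eq_mul_of_mem_jacobson {Λ : Type u} [Ring Λ] {x y : Λ}
    (hy : y ∈ Ring.jacobson Λ) (h : x = x * y) : x = 0 := by
  obtain ⟨t, ht⟩ := exists_mul_one_sub_eq_one_of_mem_jacobson hy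
  have h0 : x * (1 - y) = 0 := by rw [mul_sub, mul_one, ← h, sub_self]
  rw [← mul_one x, ← ht, ← mul_assoc, h0, zero_mul]

/-- If `x ^ n Λ` is minimal among the powers, then `x ^ n = x ^ n * (x * r)` with `x * r` in the
radical, so `x ^ n = 0`. -/
theorem PrincipalRightDCC.isNilpotent {Λ : Type u} [Ring Λ] (h : PrincipalRightDCC Λ) {x : Λ}
    (hx : x ∈ Ring.jacobson Λ) : IsNilpotent x := by
  obtain ⟨_, ⟨n, rfl⟩, hn⟩ := WellFounded.has_min h (Set.range fun n : ℕ => x ^ n) ⟨_, 0, rfl⟩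
  have := hn (x ^ (n + 1)) ⟨n + 1, rfl⟩
  push Not at this
  obtain ⟨r, hr⟩ := this ⟨x, pow_succ x n⟩
  refine ⟨n, eq_zero_of_eq_mul_of_mem_jacobson (y := x * r) (Ideal.mul_mem_right _ _ hx) ?_⟩
  rw [← mul_assoc, ← pow_succ]
  exact hr

/-- Over a ring with descending chain condition on principal right ideals, Nakayama's lemma holds
for all left modules. -/
theorem PrincipalRightDCC.nakayama {Λ : Type u} [Ring Λ] (h : PrincipalRightDCC Λ) {M : Type v}
    [AddCommGroup M] [Module Λ M] (hM : Ring.jacobson Λ • (⊤ : Submodule Λ M) = ⊤) (m : M) :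
    m = 0 := by
  -- Induction on `r Λ`. Write `m` as a sum of terms `a • n` with `a` in the radical. If `r a Λ = r
  -- Λ`, then `r = 0`; otherwise `r * a` lies strictly below `r` and kills `n` by induction.
  have key : ∀ r : Λ, ∀ m : M, r • m = 0 := by
    intro r
    induction r using h.induction with
    | _ r ih =>
    intro m
    have hm : m ∈ Ring.jacobson Λ • (⊤ : Submodule Λ M) := by rw [hM]; exact Submodule.mem_top
    induction hm using Submodule.smul_induction_on' with
    | add x _ y _ hx hy => rw [smul_add, hx, hy, add_zero]
    | smul a ha n _ =>
      rw [smul_smul]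
      by_cases hr : ∃ s, r = r * a * s
      · obtain ⟨s, hs⟩ := hr
        have hr0 : r = 0 := eq_zero_of_eq_mul_of_mem_jacobson (y := a * s)
          (Ideal.mul_mem_right _ _ ha) (by rw [← mul_assoc]; exact hs)
        rw [hr0, zero_mul, zero_smul]
      · push Not at hr
        exact ih (r * a) ⟨⟨a, rfl⟩, hr⟩ n
  rw [← one_smul Λ m, key]

theorem PrincipalRightDCC.eq_top_of_sup_eq_top {Λ : Type u} [Ring Λ] (h : PrincipalRightDCC Λ)
    {M : Type v} [AddCommGroup M] [Module Λ M] {L : Submodule Λ M}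
    (hL : L ⊔ Ring.jacobson Λ • (⊤ : Submodule Λ M) = ⊤) : L = ⊤ := by
  rw [Submodule.eq_top_iff']
  intro x
  rw [← Submodule.Quotient.mk_eq_zero]
  refine h.nakayama ?_ _
  have := congrArg (Submodule.map L.mkQ) hL
  rw [Submodule.map_sup, Submodule.map_smul'', Submodule.map_top, Submodule.range_mkQ,
    Submodule.mkQ_map_self, bot_sup_eq] at this
  exact this

theorem PrincipalRightDCC.of_surjective {Λ : Type u} {S : Type v} [Ring Λ] [Ring S]
    (h : PrincipalRightDCC Λ) (f : Λ →+* S) (hf : Function.Surjective f) :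
    PrincipalRightDCC S := by
  refine WellFounded.wellFounded_iff_has_min.2 fun T hT => ?_
  obtain ⟨x, hx, hmin⟩ := WellFounded.has_min h (f ⁻¹' T) (hT.preimage hf)
  refine ⟨f x, hx, ?_⟩
  rintro _ hy ⟨⟨b, rfl⟩, hr⟩
  obtain ⟨b, rfl⟩ := hf b
  refine hmin (x * b) (by simpa using hy) ⟨⟨b, rfl⟩, fun r e => hr (f r) ?_⟩
  rw [← map_mul, ← map_mul, ← e]

/-- A semiprime ring with descending chain condition on principal left ideals is semisimple. -/
theorem isSemisimpleRing_of_wellFounded {T : Type u} [Ring T]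
    (h : WellFounded fun y x : T => (∃ b, y = b * x) ∧ ∀ r, x ≠ r * y)
    (hT : ∀ x : T, (∀ s, x * s * x = 0) → x = 0) : IsSemisimpleRing T := by
  -- Choose an idempotent `g` with `T (1 - g)` semisimple and `T g` minimal. If `g ≠ 0`, a minimal
  -- left ideal inside `T g` is generated by an idempotent `e`, and `g - g * e` contradicts
  -- minimality.
  obtain ⟨g, ⟨hg, hss⟩, hmin⟩ := h.has_min
    {g : T | g * g = g ∧ IsSemisimpleModule T (Submodule.span T {1 - g})}
    ⟨1, by simp, by
      rw [sub_self, Submodule.span_zero_singleton]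
      have : IsSemisimpleModule T PUnit.{u + 1} :=
        { toComplementedLattice := ⟨fun a => ⟨⊥, by simp [isCompl_iff, Subsingleton.elim a ⊤]⟩⟩ }
      exact IsSemisimpleModule.of_injective (0 : (⊥ : Submodule T T) →ₗ[T] PUnit.{u + 1})
        (Function.injective_of_subsingleton _)⟩
  by_cases hg0 : g = 0
  · rw [hg0, sub_zero] at hss
    have e : Submodule.span T {(1 : T)} = ⊤ := Ideal.span_singleton_one
    rw [e] at hss
    exact IsSemisimpleModule.congr (Submodule.topEquiv (R := T) (M := T)).symm
  exfalso
  obtain ⟨x, ⟨⟨c, hc⟩, hx0⟩, hxmin⟩ := h.has_min {x : T | (∃ c, x = c * g) ∧ x ≠ 0}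
    ⟨g, ⟨1, by simp⟩, hg0⟩
  have hgen : ∀ b, b * x ≠ 0 → ∃ r, x = r * (b * x) := by
    intro b hb
    by_contra! hr
    exact hxmin (b * x) ⟨⟨b * c, by rw [hc, mul_assoc]⟩, hb⟩ ⟨⟨b, rfl⟩, hr⟩
  have hxg : x * g = x := by rw [hc, mul_assoc, hg]
  obtain ⟨s, hs⟩ : ∃ s, x * s * x ≠ 0 := by
    by_contra! hs
    exact hx0 (hT x hs)
  -- right multiplication by `s * x` is bijective on the minimal left ideal generated by `x`
  obtain ⟨r, hr⟩ := hgen (x * s) hs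
  have hinj : ∀ b, b * x * (s * x) = 0 → b * x = 0 := by
    intro b hb
    by_contra hb0
    obtain ⟨q, hq⟩ := hgen b hb0
    apply hs
    have : x * s * x = q * (b * x * (s * x)) := by
      calc x * s * x = q * (b * x) * s * x := by rw [← hq]
        _ = _ := by noncomm_ring
    rw [this, hb, mul_zero]
  -- `e` is the preimage of `s * x` under right multiplication by `s * x` on `T x`; injectivity of
  -- that map makes `e` idempotent.
  set e := s * r * x with he
  have hes : e * (s * x) = s * x := by
    conv_rhs => rw [hr]
    rw [he]
    noncomm_ring
  have hee : e * e = e := by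
    have h0 : (s * r * x * (s * r) - s * r) * x = 0 := by
      apply hinj
      have : (s * r * x * (s * r) - s * r) * x * (s * x) = e * (e * (s * x)) - e * (s * x) := by
        rw [he]; noncomm_ring
      rw [this, hes, hes, sub_self]
    rw [sub_mul, sub_eq_zero, mul_assoc _ (s * r) x] at h0
    exact h0
  have heg : e * g = e := by rw [he, mul_assoc, hxg]
  have he0 : e ≠ 0 := by
    intro h0
    rw [h0, zero_mul] at hes
    exact hs (by rw [mul_assoc, ← hes, mul_zero])
  have hsimple : IsSimpleModule T (Submodule.span T {e}) := by
    rw [isSimpleModule_iff_toSpanSingleton_surjective]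
    refine ⟨⟨0, ⟨e, Submodule.mem_span_singleton_self e⟩,
      fun h0 => he0 (congrArg Subtype.val h0).symm⟩, ?_⟩
    rintro ⟨y, hy⟩ hy0 ⟨z, hz⟩
    obtain ⟨b, rfl⟩ := Submodule.mem_span_singleton.1 hy
    obtain ⟨d, rfl⟩ := Submodule.mem_span_singleton.1 hz
    have hb : b * (s * r) * x ≠ 0 := fun h0 => hy0 (Subtype.ext (by
      simpa [he, mul_assoc] using h0))
    obtain ⟨r', hr'⟩ := hgen _ hb
    refine ⟨d * (s * r) * r', Subtype.ext ?_⟩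
    simp only [LinearMap.toSpanSingleton_apply, Submodule.coe_smul, smul_eq_mul]
    conv_rhs => rw [he, hr']
    rw [he]
    noncomm_ring
  have hge : (g - g * e) * e = 0 := by rw [sub_mul, mul_assoc, hee, sub_self]
  refine hmin (g - g * e) ⟨?_, ?_⟩ ⟨⟨g - g * e, ?_⟩, ?_⟩
  · have : (g - g * e) * (g - g * e) = (g - g * e) * g - (g - g * e) * g * e := by noncomm_ring
    rw [this]
    have h2 : (g - g * e) * g = g - g * e := by rw [sub_mul, hg, mul_assoc, heg]
    rw [h2, hge, sub_zero]
  · have hsup := IsSemisimpleModule.sup hss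
      (inferInstance : IsSemisimpleModule T (Submodule.span T {e}))
    have hle : Submodule.span T {1 - (g - g * e)} ≤
        Submodule.span T {1 - g} ⊔ Submodule.span T {e} := by
      rw [Submodule.span_singleton_le_iff_mem]
      have : 1 - (g - g * e) = (1 - g) + g • e := by rw [smul_eq_mul]; abel
      rw [this]
      exact Submodule.add_mem_sup (Submodule.mem_span_singleton_self _)
        (Submodule.smul_mem _ _ (Submodule.mem_span_singleton_self _))
    exact IsSemisimpleModule.of_injective (Submodule.inclusion hle)
      (Submodule.inclusion_injective hle)
  · rw [sub_mul, hg, mul_assoc, heg]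
  · intro r' hr'
    apply he0
    calc e = e * g * e := by rw [heg, hee]
      _ = e * (r' * (g - g * e)) * e := by rw [← hr']
      _ = e * r' * ((g - g * e) * e) := by noncomm_ring
      _ = 0 := by rw [hge, mul_zero]

/-- Since `(y * x) ^ 2 = 0`, the element `1 - y * x` inverts `1 + y * x`. This makes the quotient by
the radical semiprime. -/
theorem mem_jacobson_of_forall_mul_mul_eq_zero {Λ : Type u} [Ring Λ] {x : Λ}
    (hx : ∀ s, x * s * x = 0) : x ∈ Ring.jacobson Λ := by
  rw [← Ideal.jacobson_bot, Ideal.mem_jacobson_iff]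
  intro y
  refine ⟨1 - y * x, ?_⟩
  rw [Ideal.mem_bot]
  have : (1 - y * x) * y * x + (1 - y * x) - 1 = -(y * (x * y * x)) := by noncomm_ring
  rw [this, hx, mul_zero, neg_zero]

/-- Semisimplicity is left-right symmetric, so the criterion for left ideals is applied to the
opposite ring. -/
theorem PrincipalRightDCC.isSemisimpleRing_quotient {Λ : Type u} [Ring Λ]
    (h : PrincipalRightDCC Λ) : IsSemisimpleRing (Λ ⧸ Ring.jacobson Λ) := by
  rw [← isSemisimpleRing_mulOpposite_iff]
  have hS := h.of_surjective (Ideal.Quotient.mk (Ring.jacobson Λ)) Ideal.Quotient.mk_surjective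
  refine isSemisimpleRing_of_wellFounded ?_ ?_
  · refine Subrelation.wf ?_ (InvImage.wf MulOpposite.unop hS)
    rintro y x ⟨⟨b, rfl⟩, hr⟩
    exact ⟨⟨b.unop, by simp⟩, fun r e => hr (MulOpposite.op r) (MulOpposite.unop_injective e)⟩
  · intro x hx
    have hx' : ∀ s, x.unop * s * x.unop = 0 := fun s => by
      have := congrArg MulOpposite.unop (hx (MulOpposite.op s))
      simpa [mul_assoc] using this
    apply MulOpposite.unop_injective
    rw [MulOpposite.unop_zero]
    exact (Ring.jacobson_quotient_jacobson (R := Λ)).le (mem_jacobson_of_forall_mul_mul_eq_zero hx')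


/-- Below a maximal left ideal `m`, the left ideal generated by a suitable idempotent meets `m` only
inside the radical. -/
theorem PrincipalRightDCC.exists_idempotent {Λ : Type u} [Ring Λ] (h : PrincipalRightDCC Λ)
    {m : Submodule Λ Λ} (hm : IsCoatom m) :
    ∃ f : Λ, f * f = f ∧ 1 - f ∈ m ∧ ∀ r, r * f ∈ m → r * f ∈ Ring.jacobson Λ := by
  have hJm : Ring.jacobson Λ ≤ m := sInf_le hm
  have hss := h.isSemisimpleRing_quotient
  -- Modulo the radical `m` has a complement `C`, generated by the component `c` of `1`; `f` is a
  -- lift of this idempotent.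
  obtain ⟨C, hC⟩ := exists_isCompl
    (Submodule.map (Ideal.Quotient.mk (Ring.jacobson Λ)).toSemilinearMap m)
  have h1 : (1 : Λ ⧸ Ring.jacobson Λ) ∈
      Submodule.map (Ideal.Quotient.mk (Ring.jacobson Λ)).toSemilinearMap m ⊔ C := by
    rw [hC.sup_eq_top]; exact Submodule.mem_top
  obtain ⟨_, ⟨a, ha, rfl⟩, c, hc, hac⟩ := Submodule.mem_sup.1 h1
  change Ideal.Quotient.mk (Ring.jacobson Λ) a + c = 1 at hac
  have hdisj : ∀ r : Λ, r ∈ m → Ideal.Quotient.mk (Ring.jacobson Λ) r ∈ C →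
      Ideal.Quotient.mk (Ring.jacobson Λ) r = 0 := fun r hr hr' =>
    (Submodule.disjoint_def.1 hC.disjoint) _ ⟨r, hr, rfl⟩ hr'
  have hcc : IsIdempotentElem c := by
    have : Ideal.Quotient.mk (Ring.jacobson Λ) a * c = 0 := by
      obtain ⟨c', rfl⟩ := Ideal.Quotient.mk_surjective c
      rw [← map_mul]
      apply hdisj
      -- `m` is only a left ideal, so `a * c' ∈ m` needs this rewriting with `1 - a - c'` in the
      -- radical.
      · have : a * c' = a - a * a - (a * (1 - a - c')) := by noncomm_ring
        rw [this]
        refine sub_mem (sub_mem ha (m.smul_mem a ha)) (m.smul_mem a (hJm ?_))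
        rw [← Ideal.Quotient.eq_zero_iff_mem, map_sub, map_sub, map_one, ← hac]
        abel
      · rw [map_mul]; exact C.smul_mem _ hc
    have e := congrArg (· * c) hac
    simp only [add_mul, one_mul, this, zero_add] at e
    exact e
  -- Idempotents lift because the radical is nil.
  obtain ⟨f, hf, hfc⟩ := exists_isIdempotentElem_eq_of_ker_isNilpotent
    (Ideal.Quotient.mk (Ring.jacobson Λ))
    (fun x hx => h.isNilpotent (by rwa [Ideal.mk_ker] at hx)) c
    (by simpa using Ideal.Quotient.mk_surjective c) hcc
  refine ⟨f, hf, ?_, ?_⟩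
  · have : 1 - f = a + (1 - f - a) := by abel
    rw [this]
    refine add_mem ha (hJm ?_)
    rw [← Ideal.Quotient.eq_zero_iff_mem, map_sub, map_sub, map_one, ← hac, hfc]
    abel
  · intro r hr
    rw [← Ideal.Quotient.eq_zero_iff_mem]
    refine hdisj _ hr ?_
    rw [map_mul, hfc]
    exact C.smul_mem _ hc

/-- Take `Λ f → S`, `r f ↦ r s`, with `f` the idempotent belonging to the annihilator of `s ≠ 0`. A
kernel element `x` lies in the radical, and `x = x • f`. -/
theorem PrincipalRightDCC.exists_projective_of_isSimpleModule {Λ : Type u} [Ring Λ]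
    (h : PrincipalRightDCC Λ) (S : Type u) [AddCommGroup S] [Module Λ S] [IsSimpleModule Λ S] :
    ∃ (P : Type u) (_ : AddCommGroup P) (_ : Module Λ P) (p : P →ₗ[Λ] S), Module.Projective Λ P ∧
      Function.Surjective p ∧ LinearMap.ker p ≤ Ring.jacobson Λ • ⊤ := by
  have := IsSimpleModule.nontrivial Λ S
  obtain ⟨s, hs⟩ := exists_ne (0 : S)
  have hm := LinearMap.isCoatom_ker_of_surjective
    (IsSimpleModule.toSpanSingleton_surjective Λ hs)
  obtain ⟨f, hf, hf1, hf2⟩ := h.exists_idempotent hm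
  have hfs : f • s = s := by
    have : (1 - f) • s = 0 := hf1
    rw [sub_smul, one_smul, sub_eq_zero] at this
    exact this.symm
  have hfP : ∀ x : Submodule.span Λ {f}, x.1 * f = x.1 := by
    rintro ⟨x, hx⟩
    obtain ⟨r, rfl⟩ := Submodule.mem_span_singleton.1 hx
    simp [mul_assoc, hf]
  refine ⟨Submodule.span Λ {f}, inferInstance, inferInstance,
    (LinearMap.toSpanSingleton Λ S s).comp (Submodule.subtype _), ?_, ?_, ?_⟩
  · refine Module.Projective.of_split (M := Λ) (Submodule.subtype _)
      (LinearMap.toSpanSingleton Λ _ ⟨f, Submodule.mem_span_singleton_self f⟩) ?_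
    ext x
    simpa using hfP x
  · intro y
    obtain ⟨r, hr⟩ := IsSimpleModule.toSpanSingleton_surjective Λ hs y
    refine ⟨⟨r * f, Submodule.smul_mem _ r (Submodule.mem_span_singleton_self f)⟩, ?_⟩
    simpa [mul_smul, hfs] using hr
  · intro x hx
    have hxm : x.1 * f ∈ Ring.jacobson Λ := hf2 _ (by rw [hfP]; exact hx)
    rw [hfP] at hxm
    have : x = x.1 • (⟨f, Submodule.mem_span_singleton_self f⟩ : Submodule.span Λ {f}) :=
      Subtype.ext (hfP x).symm
    rw [this]
    exact Submodule.smul_mem_smul hxm Submodule.mem_top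

theorem PrincipalRightDCC.exists_projective_of_isSemisimpleModule {Λ : Type u} [Ring Λ]
    (h : PrincipalRightDCC Λ) (S : Type u) [AddCommGroup S] [Module Λ S]
    [IsSemisimpleModule Λ S] :
    ∃ (P : Type u) (_ : AddCommGroup P) (_ : Module Λ P) (p : P →ₗ[Λ] S), Module.Projective Λ P ∧
      Function.Surjective p ∧ LinearMap.ker p ≤ Ring.jacobson Λ • ⊤ := by
  classical
  obtain ⟨I, e, -, hI⟩ := IsSemisimpleModule.exists_linearEquiv_dfinsupp Λ S
  choose P hP1 hP2 p hP hsurj hker using fun i : I =>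
    h.exists_projective_of_isSimpleModule (i.1 : Submodule Λ S)
  refine ⟨Π₀ i, P i, inferInstance, inferInstance,
    e.symm.toLinearMap.comp (DFinsupp.mapRange.linearMap p), inferInstance, ?_, ?_⟩
  · refine e.symm.surjective.comp ?_
    exact (DFinsupp.mapRange_surjective _ fun i => map_zero (p i)).2 hsurj
  · intro x hx
    have hx' : ∀ i, x i ∈ LinearMap.ker (p i) := by
      intro i
      have h0 : DFinsupp.mapRange.linearMap p x = 0 := by simpa using hx
      simpa using DFunLike.congr_fun h0 i
    rw [← DFinsupp.sum_single (f := x)]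
    refine Submodule.sum_mem _ fun i _ => ?_
    have := Submodule.mem_map_of_mem (f := DFinsupp.lsingle (R := Λ) (M := P) i) (hker i (hx' i))
    rw [Submodule.map_smul''] at this
    exact Submodule.smul_mono le_rfl le_top this

/-- With `J` the radical, `M / J M` is semisimple and receives a projective `P` with kernel inside
`J P`. A lift `P → M` is a projective cover, by Nakayama for both surjectivity and superfluity. -/
theorem PrincipalRightDCC.isLeftPerfect {Λ : Type u} [Ring Λ] (h : PrincipalRightDCC Λ) :
    IsLeftPerfect Λ := by
  intro M
  set N : Submodule Λ M := Ring.jacobson Λ • ⊤ with hN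
  have htor : Module.IsTorsionBySet Λ (M ⧸ N) (Ring.jacobson Λ) := by
    rw [Module.isTorsionBySet_quotient_iff]
    exact fun m i hi => Submodule.smul_mem_smul hi trivial
  have hss : IsSemisimpleModule Λ (M ⧸ N) := by
    have := h.isSemisimpleRing_quotient
    let _ := htor.module
    exact (htor.semilinearMap.isSemisimpleModule_iff_of_bijective Function.bijective_id).2
      inferInstance
  obtain ⟨P, _, _, p, hP, hsurj, hker⟩ := h.exists_projective_of_isSemisimpleModule (M ⧸ N)
  obtain ⟨q, hq⟩ := Module.projective_lifting_property N.mkQ p N.mkQ_surjective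
  refine ⟨ModuleCat.of Λ P, q, hP, ?_, ?_⟩
  · rw [← LinearMap.range_eq_top]
    apply h.eq_top_of_sup_eq_top
    rw [Submodule.eq_top_iff']
    intro x
    obtain ⟨y, hy⟩ := hsurj (N.mkQ x)
    rw [← hq] at hy
    have : x - q y ∈ N := by
      rw [← Submodule.ker_mkQ N, LinearMap.mem_ker, map_sub, ← hy]
      simp
    rw [← add_sub_cancel (q y) x]
    exact Submodule.add_mem_sup ⟨y, rfl⟩ this
  · intro L hL
    apply h.eq_top_of_sup_eq_top
    refine top_le_iff.1 (hL.symm.le.trans (sup_le_sup_left (le_trans ?_ hker) L))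
    intro x hx
    rw [LinearMap.mem_ker] at hx ⊢
    rw [← hq, LinearMap.comp_apply, hx, map_zero]

end Perfect

/-! ### Chase: consequences of the projectivity of products. -/

section Products

/-- If `i` embeds a product of copies of `Λ` into a direct sum of copies of `Λ`, then for every
descending chain of principal right ideals `x n Λ`, there are an `n` and a finite set `T` such that
`i` maps `x n w`, for `w` supported on `[n, ∞)`, into `⋂ₘ x m Λ` outside of `T`. -/
theorem exists_finset_forall_mem_range {Λ : Type u} [Ring Λ] {Y : Type v} {κ : Type w}
    (i : (ℕ → Y → Λ) →ₗ[Λ] (κ →₀ Λ)) (x : ℕ → Λ)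
    (hx : Antitone fun n => (AddMonoidHom.mulLeft (x n)).range) :
    ∃ (n : ℕ) (T : Finset κ), ∀ w : ℕ → Y → Λ, (∀ j < n, w j = 0) →
      ∀ β ∉ T, ∀ m, i (x n • w) β ∈ (AddMonoidHom.mulLeft (x m)).range := by
  classical
  by_contra! hcon
  choose w hw β hβ m hm using hcon
  -- Gliding hump: a state holds the next index `N k` and all coordinates used so far. Taking `N (k
  -- + 1) ≥ M k` lets the later terms stay inside `x (M k) Λ`.
  let st : ℕ → ℕ × Finset κ := fun k => k.rec (0, ∅) fun _ p =>
    (max (m p.1 p.2) (p.1 + 1), p.2 ∪ (i (x p.1 • w p.1 p.2)).support)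
  let N : ℕ → ℕ := fun k => (st k).1
  let W : ℕ → ℕ → Y → Λ := fun k => w (st k).1 (st k).2
  let B : ℕ → κ := fun k => β (st k).1 (st k).2
  let M : ℕ → ℕ := fun k => m (st k).1 (st k).2
  have hN1 : ∀ k, N k < N (k + 1) := fun k =>
    lt_of_lt_of_le (Nat.lt_succ_self _) (le_max_right (m (st k).1 (st k).2) (N k + 1))
  have hNM : ∀ k, M k ≤ N (k + 1) := fun k => le_max_left _ _
  have hNmono : StrictMono N := strictMono_nat_of_lt_succ hN1
  have hW : ∀ k, ∀ j < N k, W k j = 0 := fun k => hw _ _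
  have hB : ∀ k, i (x (N k) • W k) (B k) ∉ (AddMonoidHom.mulLeft (x (M k))).range :=
    fun k => hm _ _
  have hsupp : ∀ k l, l < k → (i (x (N l) • W l)).support ⊆ (st k).2 := by
    intro k
    induction k with
    | zero => intro l hl; omega
    | succ k ih =>
      intro l hl
      have hst : (st (k + 1)).2 = (st k).2 ∪ (i (x (N k) • W k)).support := rfl
      rw [hst]
      rcases Nat.lt_succ_iff_lt_or_eq.1 hl with h | rfl
      · exact (ih l h).trans Finset.subset_union_left
      · exact Finset.subset_union_right
  have hB0 : ∀ k l, l < k → i (x (N l) • W l) (B k) = 0 := by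
    intro k l hl
    by_contra h0
    exact hβ (st k).1 (st k).2 (hsupp k l hl (Finsupp.mem_support_iff.2 h0))
  have hBne : ∀ k, i (x (N k) • W k) (B k) ≠ 0 := fun k h0 => hB k (h0 ▸ zero_mem _)
  have hBinj : Function.Injective B := by
    intro k l hkl
    by_contra hne
    rcases lt_or_gt_of_ne hne with h | h
    · exact hBne k (hkl ▸ hB0 l k h)
    · exact hBne l (hkl ▸ hB0 k l h)
  -- The infinite sum of all `x (N k) • W k`: at position `j` the terms with `k > j` vanish, since
  -- `N k ≥ k`.
  let z : ℕ → Y → Λ := fun j => ∑ k ∈ Finset.range (j + 1), x (N k) • W k j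
  have htail : ∀ k, ∃ w' : ℕ → Y → Λ,
      z = ∑ l ∈ Finset.range (k + 1), x (N l) • W l + x (N (k + 1)) • w' := by
    intro k
    have hmem : ∀ j y, (z - ∑ l ∈ Finset.range (k + 1), x (N l) • W l) j y ∈
        (AddMonoidHom.mulLeft (x (N (k + 1)))).range := by
      intro j y
      have h1 : (z - ∑ l ∈ Finset.range (k + 1), x (N l) • W l) j y =
          ∑ l ∈ Finset.range (j + 1), x (N l) * W l j y -
            ∑ l ∈ Finset.range (k + 1), x (N l) * W l j y := by
        simp [z, Finset.sum_apply]
      rw [h1]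
      rcases le_total (k + 1) (j + 1) with hkj | hkj
      · rw [← Finset.sum_Ico_eq_sub _ hkj]
        refine sum_mem fun l hl => ?_
        exact hx (hNmono.monotone (Finset.mem_Ico.1 hl).1) ⟨W l j y, rfl⟩
      · rw [← neg_sub, ← Finset.sum_Ico_eq_sub _ hkj, Finset.sum_eq_zero, neg_zero]
        · exact zero_mem _
        · intro l hl
          have : j < N l := lt_of_lt_of_le (Finset.mem_Ico.1 hl).1 (hNmono.le_apply)
          rw [hW l j this, Pi.zero_apply, mul_zero]
    choose w' hw' using hmem
    refine ⟨w', ?_⟩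
    rw [← sub_eq_iff_eq_add']
    ext j y
    exact (hw' j y).symm
  -- At `B k` the earlier terms vanish and the tail lies in `x (M k) Λ`, whereas the `k`-th term
  -- does not. So `i z` has infinite support.
  have hz : ∀ k, i z (B k) ≠ 0 := by
    intro k h0
    obtain ⟨w', hw'⟩ := htail k
    have h1 := congrArg (fun v => i v (B k)) hw'
    simp only [map_add, map_sum, Finset.sum_range_succ, Finsupp.add_apply,
      Finsupp.finsetSum_apply] at h1
    rw [h0, Finset.sum_eq_zero (fun l hl => hB0 k l (Finset.mem_range.1 hl)), zero_add,
      eq_comm, add_eq_zero_iff_eq_neg] at h1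
    apply hB k
    rw [h1]
    refine neg_mem (hx (hNM k) ?_)
    rw [map_smul, Finsupp.smul_apply]
    exact ⟨_, rfl⟩
  exact Set.infinite_of_injective_forall_mem hBinj (s := ((i z).support : Set κ))
    (fun k => by simpa using hz k) (Finset.finite_toSet _)

/-- A cardinality argument. For subsets `A` of `ℕ → Λ`, the finitely many exceptional coordinates of
`i (x n • V A)` are encoded in `ℕ → Λ`. Two distinct subsets with the same code would give `x n ∈ x
(n + 1) Λ` on a strictly descending chain, so the encoding would be injective, against Cantor. -/
theorem principalRightDCC_of_projective_pi {Λ : Type u} [Ring Λ]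
    (h : ∀ X : Type u, Module.Projective Λ (X → Λ)) : PrincipalRightDCC Λ := by
  classical
  rw [PrincipalRightDCC, wellFounded_iff_isEmpty_descending_chain]
  refine ⟨fun ⟨x, hx⟩ => ?_⟩
  have hanti : Antitone fun n => (AddMonoidHom.mulLeft (x n)).range := by
    refine antitone_nat_of_succ_le fun n => ?_
    rintro _ ⟨b, rfl⟩
    obtain ⟨c, hc⟩ := (hx n).1
    exact ⟨c * b, by simp [hc, mul_assoc]⟩
  have hproj : Module.Projective Λ (ℕ → (ℕ → Λ) → Λ) :=
    have := h (Σ _ : ℕ, (ℕ → Λ))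
    Module.Projective.of_equiv' (LinearEquiv.piCurry Λ fun (_ : ℕ) (_ : ℕ → Λ) => Λ)
  obtain ⟨i, hi⟩ := hproj
  obtain ⟨n, T, hT⟩ := exists_finset_forall_mem_range i x hanti
  let V : Set (ℕ → Λ) → ℕ → (ℕ → Λ) → Λ := fun A => Pi.single n (A.indicator 1)
  let φ : Set (ℕ → Λ) → ℕ → Λ := fun A k =>
    if hk : k < T.card then i (x n • V A) (T.equivFin.symm ⟨k, hk⟩).1 else 0
  refine Function.cantor_injective φ fun A A' hAA' => ?_
  have hmem : ∀ β, i (x n • (V A - V A')) β ∈ (AddMonoidHom.mulLeft (x (n + 1))).range := by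
    intro β
    by_cases hβ : β ∈ T
    · have h1 := congrFun hAA' (T.equivFin ⟨β, hβ⟩).1
      simp only [φ, Fin.is_lt, dite_true, Fin.eta, Equiv.symm_apply_apply] at h1
      rw [smul_sub, map_sub, Finsupp.sub_apply, h1, sub_self]
      exact zero_mem _
    · refine hT _ (fun j hj => ?_) β hβ _
      simp [V, Pi.single_eq_of_ne hj.ne]
  choose c hc using hmem
  have hdiv : x n • (V A - V A') = x (n + 1) •
      ∑ β ∈ (i (x n • (V A - V A'))).support, c β • β := by
    conv_lhs => rw [← hi (x n • (V A - V A')), Finsupp.linearCombination_apply, Finsupp.sum]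
    rw [Finset.smul_sum]
    refine Finset.sum_congr rfl fun β _ => ?_
    rw [← hc β, smul_smul]
    rfl
  have hcoord : ∀ y, ∃ r, x n * (A.indicator 1 y - A'.indicator 1 y) = x (n + 1) * r := by
    intro y
    refine ⟨_, Eq.trans ?_ (congrFun (congrFun hdiv n) y)⟩
    simp [V]
  by_contra hne
  obtain ⟨y, hy⟩ : ∃ y, ¬ (y ∈ A ↔ y ∈ A') := by
    by_contra! hy
    exact hne (Set.ext hy)
  obtain ⟨r, hr⟩ := hcoord y
  by_cases hA : y ∈ A
  · have hA' : y ∉ A' := fun h' => hy ⟨fun _ => h', fun _ => hA⟩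
    exact (hx n).2 r (by simpa [hA, hA'] using hr)
  · have hA' : y ∈ A' := by
      by_contra h'
      exact hy ⟨fun h => absurd h hA, fun h => absurd h h'⟩
    refine (hx n).2 (-r) ?_
    rw [mul_neg, ← hr]
    simp [hA, hA']

/-- The coordinate functions `m j` on `ker l` form a universal relation `∑ a j • m j = 0` in a
product of copies of `Λ`. Embedding that product into a free module exhibits finitely many
relations, and retracting and evaluating at `c` expresses `c` through them. -/
theorem isRightCoherent_of_projective_pi {Λ : Type u} [Ring Λ]
    (h : ∀ X : Type u, Module.Projective Λ (X → Λ)) : IsRightCoherent Λ := by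
  classical
  intro I hI
  have : Module.Finite Λᵐᵒᵖ I := Module.Finite.iff_fg.2 hI
  obtain ⟨n, l, hl⟩ := Module.Finite.exists_fin' Λᵐᵒᵖ I
  refine Module.finitePresentation_of_surjective l hl ?_
  let a : Fin n → Λ := fun j => (l (Pi.single j 1)).1
  have hla : ∀ c, (l c).1 = ∑ j, a j * (c j).unop := by
    intro c
    conv_lhs => rw [LinearMap.pi_apply_eq_sum_univ l c]
    rw [AddSubmonoidClass.coe_finsetSum]
    refine Finset.sum_congr rfl fun j _ => ?_
    simp only [Submodule.coe_smul, MulOpposite.smul_eq_mul_unop, a]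
    congr 4
    ext k
    simp [Pi.single_apply, eq_comm]
  let m : Fin n → LinearMap.ker l → Λ := fun j c => (c.1 j).unop
  obtain ⟨i, hi⟩ := h (LinearMap.ker l)
  have hm : ∑ j, a j • m j = 0 := by
    ext c
    have := hla c.1
    rw [LinearMap.mem_ker.1 c.2] at this
    simpa [m] using this.symm
  have hb : ∀ β, (fun j => MulOpposite.op (i (m j) β)) ∈ LinearMap.ker l := by
    intro β
    rw [LinearMap.mem_ker]
    apply Subtype.ext
    rw [hla]
    have := congrArg (fun v => i v β) hm
    simpa using this
  let T : Finset (LinearMap.ker l → Λ) := Finset.univ.biUnion fun j => (i (m j)).support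
  refine ⟨T.image fun β j => MulOpposite.op (i (m j) β), le_antisymm ?_ ?_⟩
  · rw [Submodule.span_le]
    intro _ hx
    simp only [Finset.coe_image, Set.mem_image] at hx
    obtain ⟨β, _, rfl⟩ := hx
    exact hb β
  · intro c hc
    have hcs : c = ∑ β ∈ T, MulOpposite.op (β ⟨c, hc⟩) • fun j => MulOpposite.op (i (m j) β) := by
      ext j
      apply MulOpposite.unop_injective
      have h1 := congrFun (hi (m j)) ⟨c, hc⟩
      rw [Finsupp.linearCombination_apply, Finsupp.sum_of_support_subset (i (m j))
        (Finset.subset_biUnion_of_mem (fun j => (i (m j)).support) (Finset.mem_univ j))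
        (fun β a => a • id β) (fun β _ => zero_smul _ _)] at h1
      simp only [Finset.sum_apply, Pi.smul_apply, id, smul_eq_mul] at h1
      simp only [Finset.sum_apply, Pi.smul_apply, Finset.unop_sum, smul_eq_mul,
        MulOpposite.unop_mul, MulOpposite.unop_op]
      exact h1.symm
    rw [hcs]
    refine Submodule.sum_mem _ fun β hβ => Submodule.smul_mem _ _ (Submodule.subset_span ?_)
    exact Finset.mem_coe.2 (Finset.mem_image_of_mem _ hβ)

end Products

/-! ### Flatness of products and projectivity of flat modules. -/

section Flat

/-- The equational criterion for flatness of a left module. -/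
def EquationalFlat (Λ : Type u) [Ring Λ] (M : Type v) [AddCommGroup M] [Module Λ M] : Prop :=
  ∀ (ι : Type v) [Fintype ι] (a : ι → Λ) (m : ι → M), ∑ j, a j • m j = 0 →
    ∃ (r : ℕ) (b : Fin r → ι → Λ) (y : Fin r → M), (∀ k, ∑ j, a j * b k j = 0) ∧
      ∀ j, m j = ∑ k, b k j • y k

theorem IsRightCoherent.exists_generators {Λ : Type u} [Ring Λ] (h : IsRightCoherent Λ)
    {ι : Type v} [Fintype ι] (a : ι → Λ) :
    ∃ (r : ℕ) (b : Fin r → ι → Λ), (∀ k, ∑ j, a j * b k j = 0) ∧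
      ∀ x : ι → Λ, ∑ j, a j * x j = 0 → ∃ y : Fin r → Λ, ∀ j, x j = ∑ k, b k j * y k := by
  let l := Fintype.linearCombination Λᵐᵒᵖ a
  have hfp := h (LinearMap.range l) (by
    rw [Fintype.range_linearCombination]
    exact Submodule.fg_span (Set.finite_range a))
  have hfg := Module.FinitePresentation.fg_ker l.rangeRestrict l.surjective_rangeRestrict
  rw [LinearMap.ker_rangeRestrict] at hfg
  obtain ⟨r, b, hb⟩ := Submodule.fg_iff_exists_fin_generating_family.1 hfg
  have hmem : ∀ x : ι → Λᵐᵒᵖ, x ∈ LinearMap.ker l ↔ ∑ j, a j * (x j).unop = 0 := by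
    intro x
    rw [LinearMap.mem_ker, Fintype.linearCombination_apply]
    simp [MulOpposite.smul_eq_mul_unop]
  refine ⟨r, fun k j => (b k j).unop, fun k => ?_, fun x hx => ?_⟩
  · rw [← hmem, ← hb]
    exact Submodule.subset_span ⟨k, rfl⟩
  · have hx' : (fun j => MulOpposite.op (x j)) ∈ LinearMap.ker l := by
      rw [hmem]; simpa using hx
    rw [← hb, Submodule.mem_span_range_iff_exists_fun] at hx'
    obtain ⟨c, hc⟩ := hx'
    refine ⟨fun k => (c k).unop, fun j => ?_⟩
    have := congrArg MulOpposite.unop (congrFun hc j)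
    simpa using this.symm

/-- The finite generating set of relations depends only on `a`, so the same `b` serves every
coordinate and the coordinatewise solutions assemble. -/
theorem IsRightCoherent.equationalFlat_pi {Λ : Type u} [Ring Λ] (h : IsRightCoherent Λ)
    (Z : Type v) (κ : Type w) : EquationalFlat Λ (Z → κ →₀ Λ) := by
  classical
  intro ι _ a m hm
  obtain ⟨r, b, hb, hy⟩ := h.exists_generators a
  have h0 : ∀ z β, ∑ j, a j * m j z β = 0 := by
    intro z β
    have := congrArg (fun v : Z → κ →₀ Λ => v z β) hm
    simpa using this
  choose y hy using fun z β => hy _ (h0 z β)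
  let T : Z → Finset κ := fun z => Finset.univ.biUnion fun j => (m j z).support
  refine ⟨r, b, fun k z => ∑ β ∈ T z, Finsupp.single β (y z β k), hb, fun j => ?_⟩
  funext z
  have hT : m j z = ∑ β ∈ T z, Finsupp.single β (m j z β) := by
    conv_lhs => rw [← Finsupp.sum_single (m j z)]
    exact Finsupp.sum_of_support_subset _
      (Finset.subset_biUnion_of_mem (fun j => (m j z).support) (Finset.mem_univ j)) _
      (fun β _ => Finsupp.single_zero β)
  rw [hT]
  simp only [Finset.sum_apply, Pi.smul_apply, Finset.smul_sum, Finsupp.smul_single, smul_eq_mul]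
  rw [Finset.sum_comm]
  refine Finset.sum_congr rfl fun β _ => ?_
  rw [hy z β j]
  exact map_sum (Finsupp.singleAddHom β) _ _

/-- The cover is injective. For `k` in the kernel, flatness yields an endomorphism `θ` of `P` with
values in the kernel and `θ k = k`. As the kernel is superfluous, `1 - θ` is bijective, so `k = 0`.
-/
theorem EquationalFlat.projective_of_isProjectiveCover {Λ : Type u} [Ring Λ] {P M : Type u}
    [AddCommGroup P] [Module Λ P] [AddCommGroup M] [Module Λ M] (hM : EquationalFlat Λ M)
    {p : P →ₗ[Λ] M} (hp : IsProjectiveCover p) : Module.Projective Λ M := by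
  classical
  have hP := hp.projective
  obtain ⟨i, hi⟩ := hp.projective
  have hker : LinearMap.ker p = ⊥ := by
    rw [eq_bot_iff]
    intro k hk
    have hk' : ∑ t : (i k).support, i k t • t.1 = k := by
      conv_rhs => rw [← hi k, Finsupp.linearCombination_apply, Finsupp.sum]
      exact Finset.sum_coe_sort (i k).support fun t => i k t • t
    obtain ⟨r, b, y, hb, hy⟩ := hM (i k).support (fun t => i k t) (fun t => p t.1) (by
      rw [LinearMap.mem_ker, ← hk', map_sum] at hk
      simpa using hk)
    choose z hz using fun k => hp.surjective (y k)
    -- A basis element `β` in the support of `i k` goes to `β` minus the lift of `p β` given by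
    -- flatness; all others go to `0`.
    let θ : P →ₗ[Λ] P := (Finsupp.linearCombination Λ fun β : P =>
      if h : β ∈ (i k).support then β - ∑ l, b l ⟨β, h⟩ • z l else 0).comp i
    have hθp : ∀ x, p (θ x) = 0 := by
      intro x
      simp only [θ, LinearMap.comp_apply, Finsupp.linearCombination_apply, Finsupp.sum, map_sum,
        map_smul]
      refine Finset.sum_eq_zero fun β _ => ?_
      split_ifs with h
      · rw [map_sub, map_sum, hy ⟨β, h⟩]
        simp [hz]
      · simp
    have hθk : θ k = k := by
      simp only [θ, LinearMap.comp_apply, Finsupp.linearCombination_apply, Finsupp.sum]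
      rw [← Finset.sum_coe_sort]
      simp only [Finset.coe_mem, dite_true, smul_sub, Finset.sum_sub_distrib, Subtype.coe_eta]
      rw [hk', sub_eq_self]
      simp only [Finset.smul_sum, smul_smul]
      rw [Finset.sum_comm]
      refine Finset.sum_eq_zero fun l _ => ?_
      rw [← Finset.sum_smul, hb, zero_smul]
    have hsurj : LinearMap.range (LinearMap.id - θ) = ⊤ := by
      apply hp.superfluous
      rw [Submodule.eq_top_iff']
      intro x
      have : x = (LinearMap.id - θ : P →ₗ[Λ] P) x + θ x := by simp
      rw [this]
      exact Submodule.add_mem_sup ⟨x, rfl⟩ (hθp x)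
    obtain ⟨s, hs⟩ := LinearMap.exists_rightInverse_of_surjective _ hsurj
    have hs' : ∀ x, s x - θ (s x) = x := fun x => LinearMap.congr_fun hs x
    -- Surjectivity of the section `s` gives injectivity of `1 - θ`.
    have hsr : LinearMap.range s = ⊤ := by
      apply hp.superfluous
      rw [Submodule.eq_top_iff']
      intro x
      have : x = s (x - θ x) + (x - s (x - θ x)) := by simp
      rw [this]
      refine Submodule.add_mem_sup ⟨_, rfl⟩ ?_
      rw [LinearMap.mem_ker, map_sub]
      have h1 := congrArg p (hs' (x - θ x))
      rw [map_sub p (s _), map_sub p x, hθp, hθp, sub_zero, sub_zero] at h1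
      rw [h1, sub_self]
    obtain ⟨k', rfl⟩ := LinearMap.range_eq_top.1 hsr k
    have h2 := hs' k'
    rw [hθk, sub_self] at h2
    rw [← h2, map_zero]
    exact zero_mem _
  exact Module.Projective.of_equiv'
    (LinearEquiv.ofBijective p ⟨LinearMap.ker_eq_bot.1 hker, hp.surjective⟩)

theorem projective_pi_finsupp {Λ : Type u} [Ring Λ] (hp : IsLeftPerfect Λ)
    (hc : IsRightCoherent Λ) (Z κ : Type u) : Module.Projective Λ (Z → κ →₀ Λ) := by
  obtain ⟨P, p, hcov⟩ := hp (ModuleCat.of Λ (Z → κ →₀ Λ))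
  exact (hc.equationalFlat_pi Z κ).projective_of_isProjectiveCover hcov

end Flat

/-! ### Projective preenvelopes and finite presentation of the stable functor. -/

section Preenvelope

variable {Λ : Type u} [Ring Λ]

/-- A projective preenvelope (left approximation) of a module. -/
structure IsProjectivePreenvelope {A P : ModuleCat.{u} Λ} (g : A ⟶ P) : Prop where
  projective : Module.Projective Λ P
  exists_lift : ∀ (P' : ModuleCat.{u} Λ) (f : A ⟶ P'), Module.Projective Λ P' →
    ∃ q : P ⟶ P', g ≫ q = f

/-- By Yoneda `π` is composition with some `a : A ⟶ X`. Surjectivity gives `b` such that `1 - a b`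
factors through a projective `P`, and `a f` factors through a projective `P'`. For `h : A ⟶ R` with
`R` projective, `b h` is killed by `π`, hence equals `f y`, and `h = (1 - a b) h + a f y` factors
through `P × P'`. -/
theorem exists_isProjectivePreenvelope {A : ModuleCat.{u} Λ}
    (h : IsFinitelyPresentedFunctor (stableHom A)) :
    ∃ (P : ModuleCat.{u} Λ) (g : A ⟶ P), IsProjectivePreenvelope g := by
  obtain ⟨X, Y, f, π, hπ⟩ := h
  have hnat : ∀ {B C : ModuleCat.{u} Λ} (b : X ⟶ B) (c : B ⟶ C),
      π.app C (b ≫ c) = (stableHom A).map c (π.app B b) := fun {B C} b c =>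
    ConcreteCategory.congr_hom (π.naturality c) b
  have hmap : ∀ {B C : ModuleCat.{u} Λ} (b : A ⟶ B) (c : B ⟶ C),
      (stableHom A).map c (QuotientAddGroup.mk b : (A ⟶ B) ⧸ projectiveMaps A B) =
        (QuotientAddGroup.mk (b ≫ c) : (A ⟶ C) ⧸ projectiveMaps A C) := fun _ _ => rfl
  obtain ⟨a, ha⟩ := QuotientAddGroup.mk_surjective (π.app X (𝟙 X))
  have hπa : ∀ {B : ModuleCat.{u} Λ} (c : X ⟶ B),
      π.app B c = (QuotientAddGroup.mk (a ≫ c) : (A ⟶ B) ⧸ projectiveMaps A B) := by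
    intro B c
    have := hnat (𝟙 X) c
    rw [Category.id_comp] at this
    rw [this, ← hmap, ha]
  obtain ⟨(b : X ⟶ A), hb⟩ := (hπ A).2 (QuotientAddGroup.mk (𝟙 A) : (A ⟶ A) ⧸ projectiveMaps A A)
  obtain ⟨P, i, q, hP, hiq⟩ : -(a ≫ b) + 𝟙 A ∈ projectiveMaps A A :=
    QuotientAddGroup.eq.1 ((hπa b).symm.trans hb)
  have hf0 : π.app Y f = 0 := by
    refine ((hπ Y).1 f).2 ⟨𝟙 Y, ?_⟩
    exact Category.comp_id f
  obtain ⟨P', i', q', hP', hiq'⟩ : a ≫ f ∈ projectiveMaps A Y :=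
    (QuotientAddGroup.eq_zero_iff _).1 ((hπa f).symm.trans hf0)
  refine ⟨ModuleCat.of Λ (P × P'), ModuleCat.ofHom (i.hom.prod i'.hom), ⟨inferInstance, ?_⟩⟩
  intro R h hR
  have h1 : π.app R (b ≫ h) = 0 := by
    refine (hπa _).trans ((QuotientAddGroup.eq_zero_iff _).2 ?_)
    exact ⟨R, a ≫ b ≫ h, 𝟙 R, hR, by simp⟩
  obtain ⟨(y : Y ⟶ R), hy⟩ := ((hπ R).1 _).1 h1
  have hy' : f ≫ y = b ≫ h := hy
  refine ⟨ModuleCat.ofHom ((q ≫ h).hom.coprod (q' ≫ y).hom), ?_⟩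
  have h2 : i ≫ q ≫ h = -(a ≫ b ≫ h) + h := by
    rw [← Category.assoc, hiq]
    simp
  have h3 : i' ≫ q' ≫ y = a ≫ b ≫ h := by
    rw [← Category.assoc, hiq', Category.assoc, hy']
  have h4 : i ≫ q ≫ h + i' ≫ q' ≫ y = h := by rw [h2, h3]; abel
  conv_rhs => rw [← h4]
  ext x
  simp

theorem isFinitelyPresentedFunctor_of_isProjectivePreenvelope {A P : ModuleCat.{u} Λ} {g : A ⟶ P}
    (h : IsProjectivePreenvelope g) : IsFinitelyPresentedFunctor (stableHom A) := by
  refine ⟨A, P, g,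
    { app := fun B => AddCommGrpCat.ofHom (QuotientAddGroup.mk' (projectiveMaps A B))
      naturality := fun B C c => rfl }, fun B => ⟨fun b => ?_, ?_⟩⟩
  · refine Iff.trans (QuotientAddGroup.eq_zero_iff (N := projectiveMaps A B) b) ⟨?_, ?_⟩
    · rintro ⟨R, i, q, hR, rfl⟩
      obtain ⟨s, rfl⟩ := h.exists_lift R i hR
      exact ⟨s ≫ q, (Category.assoc g s q).symm⟩
    · rintro ⟨y, rfl⟩
      exact ⟨P, g, y, h.projective, rfl⟩
  · exact QuotientAddGroup.mk_surjective

/-- Each projection to `Λ` extends along `g`; together the extensions retract `g`. -/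
theorem projective_pi_of_isProjectivePreenvelope (X : Type u) {P : ModuleCat.{u} Λ}
    {g : ModuleCat.of Λ (X → Λ) ⟶ P} (h : IsProjectivePreenvelope g) :
    Module.Projective Λ (X → Λ) := by
  have hP := h.projective
  choose q hq using fun x : X =>
    h.exists_lift (ModuleCat.of Λ Λ) (ModuleCat.ofHom (LinearMap.proj x)) inferInstance
  refine Module.Projective.of_split g.hom (LinearMap.pi fun x => (q x).hom) ?_
  refine LinearMap.ext fun v => funext fun x => ?_
  exact LinearMap.congr_fun (congrArg ModuleCat.Hom.hom (hq x)) v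

/-- The supports of the values of a map from `A` into a free module are contained in a set of
basis elements that embeds into `A × ℕ`. -/
theorem exists_injOn_iUnion_support {A : Type u} [Inhabited A] {κ : Type v} (s : A → Finset κ) :
    ∃ J : κ → A × ℕ, Set.InjOn J (⋃ a, (s a : Set κ)) := by
  classical
  let c : κ → A := fun β => if h : ∃ a, β ∈ s a then h.choose else default
  have hc : ∀ β ∈ ⋃ a, (s a : Set κ), β ∈ s (c β) := by
    intro β hβ
    have h : ∃ a, β ∈ s a := by simpa using hβ
    simp only [c, h, dite_true]
    exact h.choose_spec
  -- A basis element is recorded by some `a` whose support contains it and its position in a listing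
  -- of that support.
  refine ⟨fun β => (c β, (s (c β)).toList.idxOf β), fun β hβ γ hγ hβγ => ?_⟩
  obtain ⟨h1, h2⟩ := Prod.ext_iff.1 hβγ
  simp only at h1 h2
  rw [h1] at h2
  exact (List.idxOf_inj (by rw [← h1]; simpa using hc β hβ)).1 h2

/-- The product runs over all maps from `A` to the free module on `A × ℕ`. This one free module
suffices: a map to a projective, followed by a splitting into a free module, uses at most `A × ℕ`
many basis elements. -/
theorem exists_isProjectivePreenvelope_of_isLeftPerfect (hp : IsLeftPerfect Λ)
    (hc : IsRightCoherent Λ) (A : ModuleCat.{u} Λ) :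
    ∃ (P : ModuleCat.{u} Λ) (g : A ⟶ P), IsProjectivePreenvelope g := by
  classical
  refine ⟨ModuleCat.of Λ ((A →ₗ[Λ] (A × ℕ →₀ Λ)) → (A × ℕ →₀ Λ)),
    ModuleCat.ofHom (LinearMap.pi fun l => l), projective_pi_finsupp hp hc _ _, ?_⟩
  intro P f hP
  obtain ⟨i, hi⟩ := hP
  have : Inhabited A := ⟨0⟩
  obtain ⟨J, hJ⟩ := exists_injOn_iUnion_support fun a : A => (i (f a)).support
  let K := Function.invFunOn J (⋃ a : A, ((i (f a)).support : Set P))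
  let l : A →ₗ[Λ] (A × ℕ →₀ Λ) := (Finsupp.lmapDomain Λ Λ J).comp (i.comp f.hom)
  refine ⟨ModuleCat.ofHom ((Finsupp.linearCombination Λ id).comp
    ((Finsupp.lmapDomain Λ Λ K).comp (LinearMap.proj l))), ?_⟩
  ext a
  have h1 : Finsupp.mapDomain K (Finsupp.mapDomain J (i (f a))) = i (f a) := by
    rw [← Finsupp.mapDomain_comp]
    conv_rhs => rw [← Finsupp.mapDomain_id (v := i (f a))]
    refine Finsupp.mapDomain_congr fun β hβ => ?_
    exact hJ.leftInvOn_invFunOn (Set.mem_iUnion.2 ⟨a, hβ⟩)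
  change Finsupp.linearCombination Λ id (Finsupp.mapDomain K (Finsupp.mapDomain J (i (f a)))) = f a
  rw [h1]
  exact hi (f a)

theorem forall_isFinitelyPresentedFunctor_iff :
    (∀ A : ModuleCat.{u} Λ, IsFinitelyPresentedFunctor (stableHom A)) ↔
      IsLeftPerfect Λ ∧ IsRightCoherent Λ := by
  constructor
  · intro h
    have hpi : ∀ X : Type u, Module.Projective Λ (X → Λ) := fun X => by
      obtain ⟨P, g, hg⟩ := exists_isProjectivePreenvelope (h (ModuleCat.of Λ (X → Λ)))
      exact projective_pi_of_isProjectivePreenvelope X hg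
    exact ⟨(principalRightDCC_of_projective_pi hpi).isLeftPerfect,
      isRightCoherent_of_projective_pi hpi⟩
  · rintro ⟨hp, hc⟩ A
    obtain ⟨P, g, hg⟩ := exists_isProjectivePreenvelope_of_isLeftPerfect hp hc A
    exact isFinitelyPresentedFunctor_of_isProjectivePreenvelope hg

end Preenvelope

/-! ### Finite-dimensional algebras. -/

theorem principalRightDCC_of_finiteDimensional (K : Type t) [Field K] (Λ : Type u) [Ring Λ]
    [Algebra K Λ] [FiniteDimensional K Λ] : PrincipalRightDCC Λ := by
  refine Subrelation.wf ?_ (InvImage.wf (fun x : Λ => LinearMap.range (LinearMap.mulLeft K x))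
    wellFounded_lt)
  rintro y x ⟨⟨b, rfl⟩, hr⟩
  refine lt_of_le_of_ne ?_ fun h => ?_
  · rintro _ ⟨c, rfl⟩
    exact ⟨b * c, by simp⟩
  · have hx : x ∈ LinearMap.range (LinearMap.mulLeft K (x * b)) := by
      refine h.ge ?_; exact ⟨1, by simp⟩
    obtain ⟨r, hx⟩ := hx
    exact hr r hx.symm

theorem isRightCoherent_of_finiteDimensional (K : Type t) [Field K] (Λ : Type u) [Ring Λ]
    [Algebra K Λ] [FiniteDimensional K Λ] : IsRightCoherent Λ := by
  intro I hI
  have : FiniteDimensional K Λᵐᵒᵖ := Module.Finite.equiv (MulOpposite.opLinearEquiv K (M := Λ))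
  have : IsNoetherianRing Λᵐᵒᵖ := isNoetherian_of_tower K inferInstance
  have : Module.Finite Λᵐᵒᵖ I := Module.Finite.iff_fg.2 hI
  exact Module.finitePresentation_of_finite Λᵐᵒᵖ I

end StableHom

/-! ### Paths in acyclic quivers. -/

section Quiver

variable {Q : Type v} [Quiver.{w} Q]

theorem Quiver.HasNoOrientedCycles.wellFounded [Finite Q] (h : Quiver.HasNoOrientedCycles Q) :
    WellFounded fun a b : Q => ∃ p : Quiver.Path a b, p.length ≠ 0 := by
  have : IsTrans Q fun a b => ∃ p : Quiver.Path a b, p.length ≠ 0 :=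
    ⟨fun a b c ⟨p, hp⟩ ⟨q, _⟩ => ⟨p.comp q, by rw [Quiver.Path.length_comp]; omega⟩⟩
  have : Std.Irrefl fun a b : Q => ∃ p : Quiver.Path a b, p.length ≠ 0 :=
    ⟨fun a ⟨p, hp⟩ => hp (by rw [h a p]; rfl)⟩
  exact Finite.wellFounded_of_trans_of_irrefl _

theorem Quiver.HasNoOrientedCycles.wellFounded_flip [Finite Q] (h : Quiver.HasNoOrientedCycles Q) :
    WellFounded fun a b : Q => ∃ p : Quiver.Path b a, p.length ≠ 0 := by
  have : IsTrans Q fun a b => ∃ p : Quiver.Path b a, p.length ≠ 0 :=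
    ⟨fun a b c ⟨p, hp⟩ ⟨q, _⟩ => ⟨q.comp p, by rw [Quiver.Path.length_comp]; omega⟩⟩
  have : Std.Irrefl fun a b : Q => ∃ p : Quiver.Path b a, p.length ≠ 0 :=
    ⟨fun a ⟨p, hp⟩ => hp (by rw [h a p]; rfl)⟩
  exact Finite.wellFounded_of_trans_of_irrefl _

theorem Quiver.HasNoOrientedCycles.finite_allPaths [Finite Q] [∀ a b : Q, Finite (a ⟶ b)]
    (h : Quiver.HasNoOrientedCycles Q) : Finite (Quiver.AllPaths Q) := by
  -- A path ending at `b` is trivial or has a last arrow `c ⟶ b`, where `c` is strictly smaller than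
  -- `b`.
  have key : ∀ b : Q, Finite (Σ a, Quiver.Path a b) := by
    intro b
    induction b using h.wellFounded.induction with
    | _ b ih =>
    have : ∀ x : Σ c, (c ⟶ b), Finite (Σ a, Quiver.Path a x.1) :=
      fun x => ih x.1 ⟨x.2.toPath, one_ne_zero⟩
    refine Finite.of_surjective
      (fun y : Option (Σ x : (Σ c, (c ⟶ b)), Σ a, Quiver.Path a x.1) =>
        (y.elim ⟨b, Quiver.Path.nil⟩ fun z => ⟨z.2.1, z.2.2.cons z.1.2⟩ :
          Σ a, Quiver.Path a b)) ?_
    rintro ⟨a, _ | ⟨p, e⟩⟩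
    · exact ⟨none, rfl⟩
    · exact ⟨some ⟨⟨_, e⟩, a, p⟩, rfl⟩
  refine Finite.of_injective
    (fun p => ⟨p.2.1, p.1, p.2.2⟩ : Quiver.AllPaths Q → Σ b a, Quiver.Path a b) ?_
  rintro ⟨a, b, p⟩ ⟨a', b', p'⟩ hp
  cases hp
  rfl

/-- The first arrow of a path and the remaining path. -/
def Quiver.Path.uncons {a : Q} : ∀ {b : Q}, Quiver.Path a b →
    Option (Σ c : Q, (a ⟶ c) × Quiver.Path c b)
  | _, .nil => none
  | _, .cons .nil e => some ⟨_, e, .nil⟩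
  | _, .cons (.cons p f) e =>
    (Quiver.Path.uncons (.cons p f)).map fun x => ⟨x.1, x.2.1, x.2.2.cons e⟩

theorem Quiver.Path.uncons_toPath_comp {a c : Q} (α : a ⟶ c) {b : Q} (p : Quiver.Path c b) :
    (α.toPath.comp p).uncons = some ⟨c, α, p⟩ := by
  induction p with
  | nil => rfl
  | cons p e ih =>
    rw [Quiver.Path.comp_cons]
    generalize α.toPath.comp p = q at ih
    cases q with
    | nil => simp [Quiver.Path.uncons] at ih
    | cons q f => rw [Quiver.Path.uncons, ih]; rfl

end Quiver

/-! ### Path algebras are hereditary. -/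

namespace PathAlgebra

variable {K : Type t} {Q : Type v} [Quiver.{w} Q]

section CommRing

variable [CommRing K]

variable (K) in
open Classical in
/-- Stripping a given arrow off from the front of paths. -/
noncomputable def strip (A : Σ a c : Q, (a ⟶ c)) : PathAlgebra K Q →ₗ[K] PathAlgebra K Q :=
  Finsupp.lift (PathAlgebra K Q) K (Quiver.AllPaths Q) fun p =>
    p.2.2.uncons.elim 0 fun x =>
      if (⟨p.1, x.1, x.2.1⟩ : Σ a c : Q, (a ⟶ c)) = A then path K x.2.2 else 0

open Classical in
theorem strip_path_comp (A : Σ a c : Q, (a ⟶ c)) {a c b : Q} (α : a ⟶ c) (q : Quiver.Path c b) :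
    strip K A (path K (α.toPath.comp q)) =
      if (⟨a, c, α⟩ : Σ a c : Q, (a ⟶ c)) = A then path K q else 0 := by
  refine ((Finsupp.lift_apply _ _ _ _ _).trans (Finsupp.sum_single_index (zero_smul K _))).trans ?_
  rw [one_smul, Quiver.Path.uncons_toPath_comp]
  rfl

variable [Fintype Q]

theorem path_mul_path {a b c : Q} (p : Quiver.Path a b) (q : Quiver.Path b c) :
    path K p * path K q = path K (p.comp q) :=
  mulHom_path_comp p q

theorem path_mul_path_of_ne {a b c d : Q} (p : Quiver.Path a b) (q : Quiver.Path c d)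
    (h : b ≠ c) : path K p * path K q = 0 :=
  mulHom_path_of_ne p q h

theorem one_eq_sum : (1 : PathAlgebra K Q) =
    ∑ a : Q, path K (Quiver.Path.nil : Quiver.Path a a) := rfl

open Classical in
theorem strip_path_mul (A : Σ a c : Q, (a ⟶ c)) {a c : Q} (α : a ⟶ c) (y : PathAlgebra K Q) :
    strip K A (path K α.toPath * y) = if (⟨a, c, α⟩ : Σ a c : Q, (a ⟶ c)) = A then
      path K (Quiver.Path.nil : Quiver.Path c c) * y else 0 := by
  induction y using induction_on with
  | zero => simp
  | add x y hx hy => rw [mul_add, map_add, hx, hy, mul_add]; split_ifs <;> simp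
  | smul_path r d b q =>
    rw [mul_smul_comm, mul_smul_comm, map_smul]
    by_cases h : c = d
    · subst h
      rw [path_mul_path, strip_path_comp, path_mul_path, Quiver.Path.nil_comp]
      split_ifs <;> simp
    · rw [path_mul_path_of_ne _ _ h, path_mul_path_of_ne _ _ h]
      simp

/-- The arrows starting at a vertex are left independent. -/
theorem nil_mul_eq_zero_of_sum_eq_zero {a : Q} [Fintype (Σ c, (a ⟶ c))]
    (y : (Σ c, (a ⟶ c)) → PathAlgebra K Q) (h : ∑ x, path K x.2.toPath * y x = 0)
    (x : Σ c, (a ⟶ c)) : path K (Quiver.Path.nil : Quiver.Path x.1 x.1) * y x = 0 := by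
  classical
  have h1 := congrArg (strip K ⟨a, x⟩) h
  rw [map_sum, map_zero, Finset.sum_eq_single x] at h1
  · rwa [strip_path_mul, if_pos rfl] at h1
  · intro z _ hz
    rw [strip_path_mul, if_neg]
    intro h2
    exact hz (eq_of_heq (Sigma.mk.inj h2).2)
  · simp

end CommRing

variable [Field K] [Fintype Q]

section Radical

variable (K) (Q) (P : Type u) [AddCommGroup P] [Module (PathAlgebra K Q) P] [Module K P]

/-- The subspace of a module spanned by the images of the arrows. -/
def arrowSpan : Submodule K P :=
  Submodule.span K {z | ∃ (a c : Q) (α : a ⟶ c) (y : P), z = path K α.toPath • y}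

variable {P} {K} {Q}

theorem path_smul_mem_arrowSpan {a b : Q} (q : Quiver.Path a b) (hq : q.length ≠ 0) (y : P) :
    path K q • y ∈ arrowSpan K Q P := by
  obtain ⟨c, α, q', rfl, -⟩ := (Quiver.Path.length_ne_zero_iff_eq_comp q).1 hq
  rw [← path_mul_path, mul_smul]
  exact Submodule.subset_span ⟨a, c, α, _, rfl⟩

variable [IsScalarTower K (PathAlgebra K Q) P]

theorem exists_eq_sum_of_mem_arrowSpan (a : Q) [Fintype (Σ c, (a ⟶ c))] {x : P}
    (hx : x ∈ arrowSpan K Q P) : ∃ y : (Σ c, (a ⟶ c)) → P,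
      path K (Quiver.Path.nil : Quiver.Path a a) • x = ∑ z, path K z.2.toPath • y z := by
  classical
  induction hx using Submodule.span_induction with
  | mem x hx =>
    obtain ⟨b, c, α, y, rfl⟩ := hx
    by_cases h : a = b
    · subst h
      refine ⟨Pi.single ⟨c, α⟩ y, ?_⟩
      rw [Finset.sum_eq_single ⟨c, α⟩, Pi.single_eq_same, smul_smul, path_mul_path,
        Quiver.Path.nil_comp]
      · intro z _ hz
        rw [Pi.single_eq_of_ne hz, smul_zero]
      · simp
    · exact ⟨0, by simp [smul_smul, path_mul_path_of_ne _ _ h]⟩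
  | zero => exact ⟨0, by simp⟩
  | add x x' _ _ hx hx' =>
    obtain ⟨y, hy⟩ := hx
    obtain ⟨y', hy'⟩ := hx'
    exact ⟨y + y', by simp [hy, hy', Finset.sum_add_distrib]⟩
  | smul k x _ hx =>
    obtain ⟨y, hy⟩ := hx
    exact ⟨k • y, by simp [smul_comm _ k, hy, Finset.smul_sum]⟩

open StableHom in
-- Otherwise a functional `l` vanishes on the arrow span but not at `e_a x`, with `e_a` the trivial
-- path. Nontrivial paths land in the arrow span, so `{y | l (e_a y) = 0}` is a submodule; its sum
-- with `N` is everything, yet it is proper.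
theorem nil_smul_mem_arrowSpan {N : Submodule (PathAlgebra K Q) P} (hN : IsSuperfluous N) {x : P}
    (hx : x ∈ N) (a : Q) :
    path K (Quiver.Path.nil : Quiver.Path a a) • x ∈ arrowSpan K Q P := by
  by_contra hcon
  obtain ⟨l, hl, hlR⟩ := Submodule.exists_le_ker_of_notMem hcon
  let L : Submodule (PathAlgebra K Q) P :=
    { carrier := {y | l (path K (Quiver.Path.nil : Quiver.Path a a) • y) = 0}
      add_mem' := fun {y z} hy hz => by
        simp only [Set.mem_ofPred_eq] at hy hz ⊢
        rw [smul_add, map_add, hy, hz, add_zero]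
      zero_mem' := by simp
      smul_mem' := fun r y hy => by
        simp only [Set.mem_ofPred_eq] at hy ⊢
        induction r using induction_on with
        | zero => simp
        | add r s hr hs => rw [add_smul, smul_add, map_add, hr, hs, add_zero]
        | smul_path k b c q =>
          rw [smul_assoc, smul_comm, map_smul, smul_smul]
          by_cases hab : a = b
          · subst hab
            rw [path_mul_path, Quiver.Path.nil_comp]
            by_cases hq : q.length = 0
            · obtain rfl := Quiver.Path.eq_of_length_zero q hq
              rw [Quiver.Path.eq_nil_of_length_zero q hq, hy, smul_zero]
            · rw [LinearMap.mem_ker.1 (hlR (path_smul_mem_arrowSpan q hq y)), smul_zero]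
          · rw [path_mul_path_of_ne _ _ hab, zero_smul, map_zero, smul_zero] }
  have hL : L = ⊤ := by
    apply hN
    rw [Submodule.eq_top_iff']
    intro y
    set c : K := l (path K (Quiver.Path.nil : Quiver.Path a a) • y) /
      l (path K (Quiver.Path.nil : Quiver.Path a a) • x) with hc
    have : y = (y - c • x) + c • x := by abel
    rw [this]
    refine Submodule.add_mem_sup ?_ ?_
    · change l (path K (Quiver.Path.nil : Quiver.Path a a) • (y - c • x)) = 0
      rw [smul_sub, map_sub, smul_comm, map_smul l c, smul_eq_mul, hc, div_mul_cancel₀ _ hl, sub_self]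
    · rw [← algebraMap_smul (PathAlgebra K Q) c x]
      exact N.smul_mem _ hx
  have hxL : x ∈ L := hL ▸ Submodule.mem_top
  exact hl hxL

end Radical

open StableHom

theorem finiteDimensional [∀ a b : Q, Finite (a ⟶ b)] (h : Quiver.HasNoOrientedCycles Q) :
    FiniteDimensional K (PathAlgebra K Q) := by
  have := h.finite_allPaths
  exact inferInstanceAs (Module.Finite K (Quiver.AllPaths Q →₀ K))

theorem isLeftPerfect [∀ a b : Q, Finite (a ⟶ b)] (h : Quiver.HasNoOrientedCycles Q) :
    IsLeftPerfect (PathAlgebra K Q) :=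
  have := finiteDimensional (K := K) h
  (principalRightDCC_of_finiteDimensional K _).isLeftPerfect

theorem isRightCoherent [∀ a b : Q, Finite (a ⟶ b)] (h : Quiver.HasNoOrientedCycles Q) :
    IsRightCoherent (PathAlgebra K Q) :=
  have := finiteDimensional (K := K) h
  isRightCoherent_of_finiteDimensional K _

theorem isLeftHereditary [∀ a b : Q, Finite (a ⟶ b)] (h : Quiver.HasNoOrientedCycles Q) :
    IsLeftHereditary (PathAlgebra K Q) := by
  intro I
  obtain ⟨P, p, hp⟩ := isLeftPerfect (K := K) h (ModuleCat.of _ I)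
  let _ : Module K P := Module.compHom P (algebraMap K (PathAlgebra K Q))
  have : IsScalarTower K (PathAlgebra K Q) P := ⟨fun k r x => by
    change _ = algebraMap K (PathAlgebra K Q) k • r • x
    rw [Algebra.smul_def, mul_smul]⟩
  -- Induction from the sinks. Write `e_a x = ∑ α y_α` over the arrows `α : a ⟶ c`. Applying `p` and
  -- using independence of the arrows puts `e_c y_α` in the kernel, so it vanishes by induction, and
  -- so does `α y_α = α e_c y_α`.
  have key : ∀ a : Q, ∀ x ∈ LinearMap.ker p,
      path K (Quiver.Path.nil : Quiver.Path a a) • x = 0 := by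
    intro a
    induction a using h.wellFounded_flip.induction with
    | _ a ih =>
    intro x hx
    let _ := Fintype.ofFinite (Σ c, (a ⟶ c))
    obtain ⟨y, hy⟩ := exists_eq_sum_of_mem_arrowSpan a (nil_smul_mem_arrowSpan hp.superfluous hx a)
    rw [smul_smul, path_mul_path, Quiver.Path.comp_nil] at hy
    have h0 : ∑ z, path K z.2.toPath * (p (y z) : I).1 = 0 := by
      have h1 := congrArg (fun z => (p z : I).1) hy
      simp only [map_smul, LinearMap.mem_ker.1 hx, smul_zero, map_sum] at h1
      simpa using h1.symm
    rw [hy]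
    refine Finset.sum_eq_zero fun z _ => ?_
    have h2 : path K (Quiver.Path.nil : Quiver.Path z.1 z.1) • y z ∈ LinearMap.ker p := by
      rw [LinearMap.mem_ker, map_smul]
      exact Subtype.ext (nil_mul_eq_zero_of_sum_eq_zero (fun z => (p (y z) : I).1) h0 z)
    have h3 := ih z.1 ⟨z.2.toPath, one_ne_zero⟩ _ h2
    rw [smul_smul, path_mul_path, Quiver.Path.comp_nil] at h3
    rw [← Quiver.Path.comp_nil z.2.toPath, ← path_mul_path, mul_smul, h3, smul_zero]
  have hker : LinearMap.ker p = ⊥ := by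
    rw [eq_bot_iff]
    intro x hx
    rw [Submodule.mem_bot, ← one_smul (PathAlgebra K Q) x, one_eq_sum, Finset.sum_smul]
    exact Finset.sum_eq_zero fun a _ => key a x hx
  have := hp.projective
  exact Module.Projective.of_equiv'
    (LinearEquiv.ofBijective p ⟨LinearMap.ker_eq_bot.1 hker, hp.surjective⟩)

end PathAlgebra

theorem mainTheorem5 :
    (∀ (Λ : Type u) [Ring Λ], StableHom.IsLeftHereditary Λ →
      ((∀ A : ModuleCat.{u} Λ, StableHom.IsFinitelyPresentedFunctor (StableHom.stableHom A)) ↔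
        StableHom.IsLeftPerfect Λ ∧ StableHom.IsRightCoherent Λ)) ∧
    (∀ (K : Type t) [Field K] (Q : Type v) [Quiver.{w} Q] [Fintype Q]
        [∀ a b : Q, Finite (a ⟶ b)], Quiver.HasNoOrientedCycles Q →
      StableHom.IsLeftHereditary (PathAlgebra K Q) ∧
        StableHom.IsLeftPerfect (PathAlgebra K Q) ∧
        StableHom.IsRightCoherent (PathAlgebra K Q) ∧
        ∀ A : ModuleCat.{max t v w} (PathAlgebra K Q),
          StableHom.IsFinitelyPresentedFunctor (StableHom.stableHom A)) := by
  refine ⟨fun Λ _ _ => StableHom.forall_isFinitelyPresentedFunctor_iff, ?_⟩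
  intro K _ Q _ _ _ h
  exact ⟨PathAlgebra.isLeftHereditary h, PathAlgebra.isLeftPerfect h,
    PathAlgebra.isRightCoherent h, StableHom.forall_isFinitelyPresentedFunctor_iff.2
      ⟨PathAlgebra.isLeftPerfect h, PathAlgebra.isRightCoherent h⟩⟩
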